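/- Let $T^d=(S^1)^d$ with Haar probability measure $\mu$, and let $M(P)=\exp\int_{T^d}\log|P|\,d\mu$ denote the Mahler measure. Let $P:T^d\to\mathbb{C}$ be a continuous function without zeros whose Fourier coefficients $f=(f_\nu)_{\nu\in\mathbb{Z}^d}$ are absolutely summable, so that $P=\mathcal{F}(f)$, i.e. $P(z)=\sum_{\nu} f_\nu z^\nu$. For $r\in\mathbb{Z}^d$ put $P_r(z)=P(z^{r_1},\dots,z^{r_d})$ for $z\in S^1$, let $\Gamma_r=D(r)\mathbb{Z}$ with $D(r)=\gcd(r_1,\dots,r_d)$, let $\varphi_r:\mathbb{Z}^d\to\Gamma_r$ be the homomorphism with $\varphi_r(e_i)=r_i$, and let $f_r=\varphi_{r*}f\in L^1(\Gamma_r)$, $f_r(k)=\sum_{\varphi_r(\nu)=k}f_\nu$. Put $$q(r)=\min\{\max_i|\nu_i| : 0\neq\nu\in\mathbb{Z}^d,\ \textstyle\sum_i\nu_i r_i=0\},\qquad \min\emptyset=\infty .$$ For a discrete group $\Gamma$, let $\mathcal{N}\Gamma$ be the algebra of bounded operators on $L^2(\Gamma)$ commuting with left translations, with trace $\tau(A)=(Ae,e)$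 and Fuglede–Kadison determinant $\det_{\mathcal{N}\Gamma}A=\exp\tau(\log|A|)$ for $A$ invertible and $\det_{\mathcal{N}\Gamma}A=\lim_{\varepsilon\to0+}\det_{\mathcal{N}\Gamma}(|A|+\varepsilon)$ in general; $L^1(\Gamma)$ is viewed in $\mathcal{N}\Gamma$ via $\sum f_\gamma\gamma\mapsto\sum f_\gamma R_{\gamma^{-1}}$, where $R_\gamma x=x\gamma$. Then $f$ is invertible in the convolution algebra $L^1(\mathbb{Z}^d)$; one has $\det_{\mathcal{N}\mathbb{Z}^d}f=M(P)$ and $\det_{\mathcal{N}\Gamma_r}f_r=M(P_r)$ for all $r\in\mathbb{Z}^d$; and $$\lim_{q(r)\to\infty}\det\nolimits_{\mathcal{N}\Gamma_r}f_r=\det\nolimits_{\mathcal{N}\mathbb{Z}^d}f,\qquad \lim_{q(r)\to\infty}M(P_r)=M(P).$$ -/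

import Mathlib

open Filter Topology MeasureTheory

noncomputable section

namespace FugledeKadison

/-! ### Mahler measure -/

open Classical in
/-- The Mahler measure `exp (∫ log |P| dμ)` of an essentially bounded function `P` on a probability
space. Since `log |P|` is bounded above, its integral is a well-defined element of `ℝ ∪ {-∞}`; the
value is `-∞`, and the Mahler measure is `0`, exactly when `P` vanishes on a set of positive measure
or `log |P|` is not integrable. -/
def mahlerMeasure {X : Type*} [MeasurableSpace X] (μ : Measure X) (P : X → ℂ) : ℝ :=
  if (∀ᵐ x ∂μ, P x ≠ 0) ∧ Integrable (fun x => Real.log ‖P x‖) μ then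
    Real.exp (∫ x, Real.log ‖P x‖ ∂μ)
  else 0

/-- The Haar probability measure on the circle `ℝ / ℤ`, identified with `S¹` by
`x ↦ exp (2πix)`. -/
abbrev circleHaar : Measure UnitAddCircle := AddCircle.haarAddCircle

/-- The Haar probability measure on the torus `(ℝ / ℤ)ᵈ`. -/
abbrev torusHaar (d : ℕ) : Measure (UnitAddTorus (Fin d)) := Measure.pi fun _ => circleHaar

/-- `P_r (z) = P (z ^ r₁, …, z ^ r_d)`, with the circle written additively. -/
def restrictToLine {d : ℕ} (P : UnitAddTorus (Fin d) → ℂ) (r : Fin d → ℤ) : UnitAddCircle → ℂ :=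
  fun x => P fun i => r i • x

/-- `q (r) = min {max |ν_i| : 0 ≠ ν ∈ ℤᵈ, ∑ ν_i r_i = 0}`, with `min ∅ = ∞`. -/
def lawtonQ {d : ℕ} (r : Fin d → ℤ) : ℕ∞ :=
  ⨅ (ν : Fin d → ℤ) (_ : ν ≠ 0 ∧ ∑ i, ν i * r i = 0),
    ((Finset.univ.sup fun i => (ν i).natAbs : ℕ) : ℕ∞)

/-- The filter on `ℤᵈ` describing the limit `q (r) → ∞`. -/
def lawtonFilter (d : ℕ) : Filter (Fin d → ℤ) := comap lawtonQ (𝓝 ⊤)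

/-! ### The convolution algebra `L¹(Γ)`, for an additively written group `Γ` -/

/-- `f` is a unit of the convolution algebra `L¹(Γ)`. -/
def IsL1Unit {Γ : Type*} [AddGroup Γ] [DecidableEq Γ] (f : Γ → ℂ) : Prop :=
  Summable (fun γ => ‖f γ‖) ∧ ∃ g : Γ → ℂ, Summable (fun γ => ‖g γ‖) ∧
    DiscreteConvolution.addConvolution (LinearMap.mul ℂ ℂ) f g = Pi.single 0 1 ∧
    DiscreteConvolution.addConvolution (LinearMap.mul ℂ ℂ) g f = Pi.single 0 1

/-- Integration along the fibres `φ_* : L¹(Γ) → L¹(Γ')` of a homomorphism `φ : Γ → Γ'`. -/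
def fibreSum {Γ Γ' : Type*} [AddGroup Γ] [AddGroup Γ'] (φ : Γ →+ Γ') (f : Γ → ℂ) : Γ' → ℂ :=
  fun γ' => ∑' γ : {γ : Γ // φ γ = γ'}, f γ

/-! ### Operators on `L²(Γ)` and the Fuglede--Kadison determinant -/

/-- The Hilbert space `L²(Γ)`. -/
abbrev L2 (Γ : Type*) : Type _ := lp (fun _ : Γ => ℂ) 2

theorem memℓp_translate {Γ : Type*} [AddGroup Γ] (γ : Γ) (x : L2 Γ) :
    Memℓp (fun η => (x : Γ → ℂ) (η - γ)) 2 := by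
  have h2 : 0 < (2 : ENNReal).toReal := by norm_num
  have h := (lp.memℓp x).summable h2
  exact memℓp_gen ((Equiv.subRight γ).summable_iff.mpr h)

/-- The unitary right translation `R_γ x = x · γ` of `L²(Γ)`: for `x = ∑ x_η η` the coefficient of
`x · γ` at `η` is (in additive notation) `x_{η - γ}`. -/
def rightTranslate {Γ : Type*} [AddGroup Γ] (γ : Γ) : L2 Γ →ₗᵢ[ℂ] L2 Γ where
  toFun x := ⟨fun η => (x : Γ → ℂ) (η - γ), memℓp_translate γ x⟩
  map_add' _ _ := rfl
  map_smul' _ _ := rfl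
  norm_map' x := by
    have h2 : 0 < (2 : ENNReal).toReal := by norm_num
    rw [lp.norm_eq_tsum_rpow h2, lp.norm_eq_tsum_rpow h2]
    congr 1
    exact (Equiv.subRight γ).tsum_eq fun η => ‖(x : Γ → ℂ) η‖ ^ (2 : ENNReal).toReal

/-- The representation `r : L¹(Γ) → 𝒩Γ`, `r (∑ f_γ γ) = ∑ f_γ R_{γ⁻¹}`; for `f ∈ L¹(Γ)` the series
converges absolutely in operator norm. -/
def regularRep {Γ : Type*} [AddGroup Γ] (f : Γ → ℂ) : L2 Γ →L[ℂ] L2 Γ :=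
  ∑' γ, f γ • (rightTranslate (-γ)).toContinuousLinearMap

/-- The canonical trace `τ (A) = (A e, e)`, where `e` is the unit element of `Γ` seen in `L²(Γ)`. -/
def trace {Γ : Type*} [AddGroup Γ] [DecidableEq Γ] (A : L2 Γ →L[ℂ] L2 Γ) : ℂ :=
  inner ℂ (lp.single 2 (0 : Γ) (1 : ℂ)) (A (lp.single 2 (0 : Γ) (1 : ℂ)))

/-- The operator `|A| = (A* A)^(1/2)` on a Hilbert space. -/
def absOp {H : Type*} [NormedAddCommGroup H] [InnerProductSpace ℂ H] [CompleteSpace H]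
    (A : H →L[ℂ] H) : H →L[ℂ] H :=
  CFC.abs A

/-- The operator `log A`, by functional calculus, for a positive invertible operator `A` on a
Hilbert space. -/
def logOp {H : Type*} [NormedAddCommGroup H] [InnerProductSpace ℂ H] [CompleteSpace H]
    (A : H →L[ℂ] H) : H →L[ℂ] H :=
  CFC.log A

/-- `exp τ (log |A|)`, the Fuglede--Kadison determinant of an invertible operator. (The trace of the
self-adjoint operator `log |A|` is real.) -/
def fkDetOfUnit {Γ : Type*} [AddGroup Γ] [DecidableEq Γ] (A : L2 Γ →L[ℂ] L2 Γ) : ℝ :=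
  Real.exp (trace (logOp (absOp A))).re

open Classical in
/-- The Fuglede--Kadison determinant `det_{𝒩Γ} A` of an operator `A ∈ 𝒩Γ`: it is `exp τ (log |A|)`
if `A` is invertible, and the limit of `det_{𝒩Γ} (|A| + ε)` for `ε → 0+` in general. The group von
Neumann algebra `𝒩Γ` consists of the operators on `L²(Γ)` that commute with left translations; an
element of it is invertible in `𝒩Γ` exactly when it is invertible as an operator. -/
def fkDet {Γ : Type*} [AddGroup Γ] [DecidableEq Γ] (A : L2 Γ →L[ℂ] L2 Γ) : ℝ :=
  if IsUnit A then fkDetOfUnit A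
  else limUnder (𝓝[>] (0 : ℝ)) fun ε => fkDetOfUnit (absOp A + (ε : ℂ) • 1)

/-! ### The groups `Γ_r` -/

/-- `Γ_r = D(r) ℤ`, where `D(r)` is the greatest common divisor of `r₁, …, r_d`. -/
def gcdSubgroup {d : ℕ} (r : Fin d → ℤ) : AddSubgroup ℤ :=
  AddSubgroup.zmultiples (Finset.univ.gcd r)

theorem sum_mem_gcdSubgroup {d : ℕ} (r n : Fin d → ℤ) : ∑ i, n i * r i ∈ gcdSubgroup r :=
  Int.mem_zmultiples_iff.mpr
    (Finset.dvd_sum fun i hi => Dvd.dvd.mul_left (Finset.gcd_dvd hi) (n i))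

/-- The homomorphism `φ_r : ℤᵈ → Γ_r` with `φ_r (e_i) = r_i`. -/
def evalHom {d : ℕ} (r : Fin d → ℤ) : (Fin d → ℤ) →+ gcdSubgroup r where
  toFun n := ⟨∑ i, n i * r i, sum_mem_gcdSubgroup r n⟩
  map_zero' := by ext; simp
  map_add' m n := by ext; simp [add_mul, Finset.sum_add_distrib]

end FugledeKadison

end

/-! The Fourier transform identifies `L²(Γ)` with `L²` of a compact dual group, turns `R_{γ⁻¹}` into
multiplication by the character of `γ`, and so turns an element of `L¹(Γ)` into multiplication by
its Fourier transform `Q`. The unit vector becomes the constant `1`, hence the trace becomes the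
Haar integral. If `Q` has no zeros, functional calculus gives `log |Q|` as the symbol, and the
determinant is `M(Q)` (`fkDet_regularRep`).

For `Γ_r = Dℤ` with `D ≠ 0` the symbol `Q` of `f_r` satisfies `Q(z ^ D) = P_r(z)`; since `z ↦ z ^ D`
preserves Haar measure, `M(Q) = M(P_r)`. For `r = 0` both sides are `|P(1, …, 1)|`.

Since `P` has no zeros, `log |P|` is continuous, so the limit formula is weak convergence of the
image measures on the torus (`tendsto_integral_restrictToLine`). By density it suffices to test a
monomial `z ^ n`, whose integral along the line vanishes once `q(r) > max |n_i|`, for `n ≠ 0`.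

Invertibility of `f` is Wiener's lemma, by Gelfand theory in a commutative algebra of operators on
`ℓ¹(Γ)`. -/

open scoped CStarAlgebra

namespace FugledeKadison

noncomputable section

/-! ### Multiplication operators on `L²` -/

section Multiplication

variable {K : Type*} [TopologicalSpace K] [CompactSpace K] [MeasurableSpace K] [BorelSpace K]

/-- Multiplication by a continuous function, as an operator on `L²`. -/
def mulOp (m : Measure K) [IsFiniteMeasure m] (g : C(K, ℂ)) : Lp ℂ 2 m →L[ℂ] Lp ℂ 2 m :=
  (ContinuousLinearMap.mul ℂ ℂ).holderL m ⊤ 2 2 (ContinuousMap.toLp ⊤ m ℂ g)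

variable {m : Measure K} [IsFiniteMeasure m]

theorem coeFn_mulOp (g : C(K, ℂ)) (u : Lp ℂ 2 m) : mulOp m g u =ᵐ[m] fun x => g x * u x := by
  have h1 := (ContinuousLinearMap.mul ℂ ℂ).coeFn_holder (r := 2) (ContinuousMap.toLp ⊤ m ℂ g) u
  have h2 := ContinuousMap.coeFn_toLp (p := ⊤) (𝕜 := ℂ) m g
  filter_upwards [h1, h2] with x h1 h2
  rw [← h2]
  exact h1

theorem mulOp_toLp (g u : C(K, ℂ)) :
    mulOp m g (ContinuousMap.toLp 2 m ℂ u) = ContinuousMap.toLp 2 m ℂ (g * u) := by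
  apply Lp.ext
  filter_upwards [coeFn_mulOp g (ContinuousMap.toLp 2 m ℂ u),
    ContinuousMap.coeFn_toLp (p := 2) (𝕜 := ℂ) m u,
    ContinuousMap.coeFn_toLp (p := 2) (𝕜 := ℂ) m (g * u)] with x h1 h2 h3
  rw [h1, h2, h3, ContinuousMap.mul_apply]

/-- The representation of the continuous functions by multiplication operators on `L²`. -/
def mulRep (m : Measure K) [IsFiniteMeasure m] : C(K, ℂ) →⋆ₐ[ℂ] (Lp ℂ 2 m →L[ℂ] Lp ℂ 2 m) where
  toFun := mulOp m
  map_one' := by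
    ext1 u
    apply Lp.ext
    filter_upwards [coeFn_mulOp (1 : C(K, ℂ)) u] with x h1
    simp [h1]
  map_mul' g h := by
    ext1 u
    apply Lp.ext
    filter_upwards [coeFn_mulOp (g * h) u, coeFn_mulOp g (mulOp m h u), coeFn_mulOp h u]
      with x h1 h2 h3
    rw [mul_apply_eq_comp, h1, h2, h3, ContinuousMap.mul_apply, mul_assoc]
  map_zero' := by simp [mulOp]
  map_add' g h := by simp [mulOp]
  commutes' c := by
    ext1 u
    apply Lp.ext
    filter_upwards [coeFn_mulOp (algebraMap ℂ C(K, ℂ) c) u, Lp.coeFn_smul c u] with x h1 h2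
    rw [h1, Algebra.algebraMap_eq_smul_one, Algebra.algebraMap_eq_smul_one]
    exact (by simp : (c • (1 : C(K, ℂ))) x * u x = c * u x).trans h2.symm
  map_star' g := by
    rw [ContinuousLinearMap.star_eq_adjoint, ContinuousLinearMap.eq_adjoint_iff]
    intro u v
    rw [L2.inner_def, L2.inner_def]
    apply integral_congr_ae
    filter_upwards [coeFn_mulOp (star g) u, coeFn_mulOp g v] with x h1 h2
    rw [h1, h2]
    simp
    ring

theorem mahlerMeasure_of_ne_zero (Q : C(K, ℂ)) (hQ0 : ∀ x, Q x ≠ 0) :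
    mahlerMeasure m Q = Real.exp (∫ x, Real.log ‖Q x‖ ∂m) := by
  refine if_pos ⟨.of_forall hQ0, ?_⟩
  have := Q.continuous.norm.log fun x => norm_ne_zero_iff.2 (hQ0 x)
  exact this.integrable_of_hasCompactSupport (HasCompactSupport.of_compactSpace _)

end Multiplication

/-! ### Logarithm of the absolute value under a star representation -/

section Representation

/-- This describes `|Q| = exp l` by its square, an algebraic relation that star homomorphisms
preserve. -/
theorem exp_mul_exp_of_eq_log_norm {K : Type*} [TopologicalSpace K] [CompactSpace K] (Q l : C(K, ℂ))
    (hQ : ∀ x, Q x ≠ 0) (hl : ∀ x, l x = Real.log ‖Q x‖) :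
    NormedSpace.exp l * NormedSpace.exp l = star Q * Q := by
  ext x
  have h : NormedSpace.exp l x = Complex.exp (l x) := by
    rw [Complex.exp_eq_exp_ℂ]
    exact NormedSpace.map_exp (ContinuousMap.evalAlgHom ℂ ℂ x)
      (ContinuousEvalConst.continuous_eval_const x) l
  rw [ContinuousMap.mul_apply, h, hl, ← Complex.ofReal_exp, Real.exp_log (norm_pos_iff.2 (hQ x))]
  simp only [ContinuousMap.mul_apply, ContinuousMap.star_apply]
  rw [Complex.star_def, Complex.conj_mul']
  ring

variable {K : Type*} [TopologicalSpace K] [CompactSpace K]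

/-- A star representation of the continuous functions transports `log |Q|`. -/
theorem logOp_absOp_map {H : Type*} [NormedAddCommGroup H] [InnerProductSpace ℂ H] [CompleteSpace H]
    (π : C(K, ℂ) →⋆ₐ[ℂ] (H →L[ℂ] H)) (Q l : C(K, ℂ))
    (hQ : ∀ x, Q x ≠ 0) (hl : ∀ x, l x = Real.log ‖Q x‖) :
    logOp (absOp (π Q)) = π l := by
  have hsa : IsSelfAdjoint l := by
    ext x
    simp [hl]
  have hsa' : IsSelfAdjoint (π l) := hsa.map π
  have hexp : π (NormedSpace.exp l) = NormedSpace.exp (π l) :=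
    letI : Algebra ℚ (H →L[ℂ] H) := Algebra.compHom _ (algebraMap ℚ ℂ)
    NormedSpace.map_exp π (map_continuous π) l
  have hnn : 0 ≤ NormedSpace.exp (π l) := hsa'.exp_nonneg
  -- `exp (π l)` is positive with square `π(Q)* π(Q)`, and a positive square root is unique.
  have habs : absOp (π Q) = NormedSpace.exp (π l) := by
    apply CFC.sqrt_unique _ hnn
    rw [← hexp, ← map_mul, exp_mul_exp_of_eq_log_norm Q l hQ hl, map_mul, map_star]
  rw [habs, logOp, CFC.log_exp _ hsa']

end Representation

/-! ### Fuglede–Kadison determinants via Fourier transform -/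

section Determinant

variable {Γ : Type*} [AddCommGroup Γ] [DecidableEq Γ]
variable {K : Type*} [TopologicalSpace K] [CompactSpace K] [MeasurableSpace K] [BorelSpace K]
variable {m : Measure K} [IsProbabilityMeasure m]

theorem rightTranslate_single (γ η : Γ) :
    rightTranslate γ (lp.single 2 η (1 : ℂ)) = lp.single 2 (η + γ) (1 : ℂ) := by
  ext ζ
  change (lp.single 2 η (1 : ℂ) : Γ → ℂ) (ζ - γ) = _
  simp only [lp.coeFn_single, Pi.single_apply, sub_eq_iff_eq_add]

/-- Multiplication by `χ γ` sends `b η = χ (-η)` to `χ (-(η - γ)) = b (η - γ)`. The sign in `hb` is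
what matches the inverse in `R_{γ⁻¹}`. -/
theorem conj_mulRep_eq_rightTranslate (χ : Γ → C(K, ℂ)) (hχ : ∀ γ η, χ (γ + η) = χ γ * χ η)
    (b : HilbertBasis Γ ℂ (Lp ℂ 2 m)) (hb : ∀ γ, b γ = ContinuousMap.toLp 2 m ℂ (χ (-γ))) (γ : Γ) :
    b.repr.conjStarAlgEquiv (mulRep m (χ γ)) = (rightTranslate (-γ)).toContinuousLinearMap := by
  apply lp.ext_continuousLinearMap (by simp)
  intro η
  ext1
  change b.repr (mulOp m (χ γ) (b.repr.symm (lp.single 2 η (1 : ℂ)))) =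
    rightTranslate (-γ) (lp.single 2 η (1 : ℂ))
  rw [rightTranslate_single, b.repr_symm_single, hb, mulOp_toLp, ← hχ]
  rw [show γ + -η = -(η + -γ) by abel, ← hb, b.repr_self]

/-- The Fuglede--Kadison determinant of an element of `L¹(Γ)` in terms of its Fourier transform
with respect to characters `χ γ` on a probability space `K` whose inverses form a Hilbert basis. -/
theorem fkDet_regularRep (χ : Γ → C(K, ℂ)) (hχ : ∀ γ η, χ (γ + η) = χ γ * χ η) (hχ0 : χ 0 = 1)
    (b : HilbertBasis Γ ℂ (Lp ℂ 2 m)) (hb : ∀ γ, b γ = ContinuousMap.toLp 2 m ℂ (χ (-γ)))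
    (h : Γ → ℂ) (Q : C(K, ℂ)) (hQ : HasSum (fun γ => h γ • χ γ) Q) (hQ0 : ∀ x, Q x ≠ 0) :
    fkDet (regularRep h) = Real.exp (∫ x, Real.log ‖Q x‖ ∂m) := by
  let π : C(K, ℂ) →⋆ₐ[ℂ] (L2 Γ →L[ℂ] L2 Γ) :=
    (b.repr.conjStarAlgEquiv : _ →⋆ₐ[ℂ] (L2 Γ →L[ℂ] L2 Γ)).comp (mulRep m)
  have hπ (γ : Γ) : π (χ γ) = (rightTranslate (-γ)).toContinuousLinearMap :=
    conj_mulRep_eq_rightTranslate χ hχ b hb γ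
  have hreg : regularRep h = π Q := by
    have := hQ.map π (map_continuous π)
    have he : (fun γ => h γ • (rightTranslate (-γ)).toContinuousLinearMap) =
        π ∘ fun γ => h γ • χ γ := by
      ext1 γ
      rw [Function.comp_apply, map_smul, hπ]
    rw [regularRep, he]
    exact this.tsum_eq
  -- Invertibility selects the first branch of `fkDet`; no limit over `ε` is needed.
  have hunit : IsUnit (π Q) := (ContinuousMap.isUnit_iff_forall_ne_zero Q |>.2 hQ0).map π
  let l : C(K, ℂ) := ⟨fun x => Real.log ‖Q x‖, by
    have := Q.continuous.norm.log fun x => norm_ne_zero_iff.2 (hQ0 x)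
    fun_prop⟩
  have htr : trace (π l) = ∫ x, l x ∂m := by
    change inner ℂ (lp.single 2 (0 : Γ) (1 : ℂ))
      (b.repr (mulOp m l (b.repr.symm (lp.single 2 (0 : Γ) (1 : ℂ))))) = _
    rw [b.repr_symm_single]
    -- The unit vector at `0` corresponds to `χ 0 = 1`, so its matrix coefficient is the integral of
    -- `l`.
    rw [← b.repr_self, LinearIsometryEquiv.inner_map_map, hb, mulOp_toLp, neg_zero, hχ0,
      ContinuousMap.inner_toLp]
    simp
  rw [hreg, fkDet, if_pos hunit, fkDetOfUnit, logOp_absOp_map π Q l hQ0 fun _ => rfl, htr]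
  congr 1
  change (∫ x, ((Real.log ‖Q x‖ : ℝ) : ℂ) ∂m).re = _
  rw [integral_complex_ofReal, Complex.ofReal_re]

end Determinant

/-! ### Wiener's lemma -/

section Wiener

variable {Γ : Type*} [AddCommGroup Γ]

/-- Gelfand's criterion: an absolutely convergent combination of a bounded group of elements of a
commutative Banach algebra is invertible if no character of the group annihilates it. -/
theorem isUnit_tsum_of_forall_addChar {A : Type*} [NormedCommRing A] [NormedAlgebra ℂ A]
    [CompleteSpace A] [NormOneClass A] (T : Γ → A) (hT0 : T 0 = 1)
    (hT : ∀ γ η, T (γ + η) = T γ * T η) (hT1 : ∀ γ, ‖T γ‖ ≤ 1) (f : Γ → ℂ)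
    (hf : Summable fun γ => ‖f γ‖) (hχ : ∀ χ : AddChar Γ Circle, ∑' γ, f γ * χ γ ≠ 0) :
    ∃ a, HasSum (fun γ => f γ • T γ) a ∧ IsUnit a := by
  have hs : Summable fun γ => f γ • T γ := by
    refine .of_norm_bounded hf fun γ => ?_
    rw [norm_smul]
    exact mul_le_of_le_one_right (norm_nonneg _) (hT1 γ)
  refine ⟨_, hs.hasSum, ?_⟩
  by_contra hu
  obtain ⟨φ, hφ⟩ := WeakDual.CharacterSpace.exists_apply_eq_zero hu
  have hle (γ : Γ) : ‖φ (T γ)‖ ≤ 1 := (AlgHom.norm_apply_le_self φ (T γ)).trans (hT1 γ)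
  have hadd (γ η : Γ) : φ (T (γ + η)) = φ (T γ) * φ (T η) := by rw [hT, map_mul]
  have h0 : φ (T 0) = 1 := by rw [hT0, map_one]
  -- Both `φ (T γ)` and its inverse `φ (T (-γ))` have modulus at most `1`.
  have hnorm (γ : Γ) : ‖φ (T γ)‖ = 1 := by
    refine le_antisymm (hle γ) ?_
    have h : ‖φ (T γ)‖ * ‖φ (T (-γ))‖ = 1 := by
      rw [← norm_mul, ← hadd, add_neg_cancel, h0, norm_one]
    rw [← h]
    exact mul_le_of_le_one_right (norm_nonneg _) (hle _)
  let χ : AddChar Γ Circle :=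
    { toFun γ := ⟨φ (T γ), mem_sphere_zero_iff_norm.2 (hnorm γ)⟩
      map_zero_eq_one' := Circle.ext h0
      map_add_eq_mul' γ η := Circle.ext (hadd γ η) }
  refine hχ χ ?_
  have := hs.hasSum.map φ (map_continuous φ)
  rw [hφ] at this
  rw [← this.tsum_eq]
  congr 1
  ext1 γ
  rw [Function.comp_apply, map_smul, smul_eq_mul]
  rfl

/-- Translation by `γ` on `ℓ¹(Γ)`. -/
def translateL1 (γ : Γ) : lp (fun _ : Γ => ℂ) 1 →ₗᵢ[ℂ] lp (fun _ : Γ => ℂ) 1 where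
  toFun x := ⟨fun η => x (η - γ), memℓp_gen <| (Equiv.subRight γ).summable_iff.mpr <|
    (lp.memℓp x).summable (by norm_num)⟩
  map_add' _ _ := rfl
  map_smul' _ _ := rfl
  norm_map' x := by
    have h1 : 0 < (1 : ENNReal).toReal := by norm_num
    rw [lp.norm_eq_tsum_rpow h1, lp.norm_eq_tsum_rpow h1]
    congr 1
    exact (Equiv.subRight γ).tsum_eq fun η => ‖x η‖ ^ (1 : ENNReal).toReal

theorem translateL1_add (γ η : Γ) : (translateL1 (γ + η)).toContinuousLinearMap =
    (translateL1 γ).toContinuousLinearMap * (translateL1 η).toContinuousLinearMap := by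
  ext x ζ
  change x (ζ - (γ + η)) = x (ζ - γ - η)
  rw [sub_add_eq_sub_sub]

theorem translateL1_zero : (translateL1 (0 : Γ)).toContinuousLinearMap = 1 := by
  ext x ζ
  change x (ζ - 0) = x ζ
  rw [sub_zero]

/-- Gelfand's criterion needs a commutative Banach algebra. The double commutant of the commuting
translations is one: it is closed and contains them all. -/
theorem exists_inverse_tsum_translateL1 (f : Γ → ℂ)
    (hf : Summable fun γ => ‖f γ‖) (hχ : ∀ χ : AddChar Γ Circle, ∑' γ, f γ * χ γ ≠ 0) :
    ∃ G : lp (fun _ : Γ => ℂ) 1 →L[ℂ] lp (fun _ : Γ => ℂ) 1,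
      (∑' γ, f γ • (translateL1 γ).toContinuousLinearMap) * G = 1 := by
  classical
  let τ (γ : Γ) := (translateL1 γ).toContinuousLinearMap
  have hcomm : ∀ a ∈ Set.range τ, ∀ b ∈ Set.range τ, a * b = b * a := by
    rintro _ ⟨γ, rfl⟩ _ ⟨η, rfl⟩
    change (translateL1 γ).toContinuousLinearMap * (translateL1 η).toContinuousLinearMap =
      (translateL1 η).toContinuousLinearMap * (translateL1 γ).toContinuousLinearMap
    rw [← translateL1_add, ← translateL1_add, add_comm]
  let A : Subalgebra ℂ (lp (fun _ : Γ => ℂ) 1 →L[ℂ] lp (fun _ : Γ => ℂ) 1) :=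
    Subalgebra.centralizer ℂ (Set.range τ).centralizer
  have hA : IsClosed (A : Set (lp (fun _ : Γ => ℂ) 1 →L[ℂ] lp (fun _ : Γ => ℂ) 1)) :=
    Set.isClosed_centralizer _
  have : CompleteSpace A := hA.completeSpace_coe
  have : Nontrivial (lp (fun _ : Γ => ℂ) 1) := by
    refine ⟨lp.single 1 (0 : Γ) (1 : ℂ), 0, fun h => ?_⟩
    have := congr_arg (fun x : lp (fun _ : Γ => ℂ) 1 => x 0) h
    simp at this
  let _ : NormedCommRing A :=
    { (inferInstance : NormedRing A) with
      mul_comm a b := Subtype.ext <|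
        Set.centralizer_centralizer_comm_of_comm hcomm a a.2 b b.2 }
  have : NormOneClass A := ⟨norm_one (α := lp (fun _ : Γ => ℂ) 1 →L[ℂ] lp (fun _ : Γ => ℂ) 1)⟩
  let T (γ : Γ) : A := ⟨τ γ, Set.subset_centralizer_centralizer ⟨γ, rfl⟩⟩
  have hT1 (γ : Γ) : ‖T γ‖ ≤ 1 := (translateL1 γ).norm_toContinuousLinearMap_le
  obtain ⟨a, ha, hu⟩ := isUnit_tsum_of_forall_addChar T (Subtype.ext translateL1_zero)
    (fun γ η => Subtype.ext (translateL1_add γ η)) hT1 f hf hχ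
  obtain ⟨G, hG⟩ := hu.exists_right_inv
  refine ⟨G, ?_⟩
  have := (ha.map A.val continuous_subtype_val).tsum_eq
  have h2 := congr_arg A.val hG
  rw [map_mul, ← this, map_one] at h2
  exact h2

/-- Wiener's lemma: an element of `L¹(Γ)` whose Fourier transform has no zeros is invertible. -/
theorem isL1Unit_of_forall_addChar [DecidableEq Γ] (f : Γ → ℂ)
    (hf : Summable fun γ => ‖f γ‖) (hχ : ∀ χ : AddChar Γ Circle, ∑' γ, f γ * χ γ ≠ 0) :
    IsL1Unit f := by
  obtain ⟨G, hG⟩ := exists_inverse_tsum_translateL1 f hf hχ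
  -- Applying the operator identity `hG` to the unit mass at `0` gives `f * g = δ₀`.
  let g : lp (fun _ : Γ => ℂ) 1 := G (lp.single 1 (0 : Γ) (1 : ℂ))
  have hs : Summable fun γ => f γ • (translateL1 γ).toContinuousLinearMap := by
    refine .of_norm_bounded hf fun γ => ?_
    rw [norm_smul]
    exact mul_le_of_le_one_right (norm_nonneg _) (translateL1 γ).norm_toContinuousLinearMap_le
  have hconv : DiscreteConvolution.addConvolution (LinearMap.mul ℂ ℂ) f g = Pi.single 0 1 := by
    ext η
    have h1 := ((hs.hasSum.mapL (ContinuousLinearMap.apply ℂ _ g)).mapL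
      (lp.evalCLM ℂ (fun _ : Γ => ℂ) 1 η)).tsum_eq
    have h2 : (∑' γ, f γ • (translateL1 γ).toContinuousLinearMap) g =
        lp.single 1 (0 : Γ) (1 : ℂ) := congr($hG (lp.single 1 (0 : Γ) (1 : ℂ)))
    rw [ContinuousLinearMap.apply_apply, h2] at h1
    let e : Γ ≃ DiscreteConvolution.addFiber η :=
      { toFun γ := ⟨(γ, η - γ), DiscreteConvolution.mem_addFiber.2 (add_sub_cancel γ η)⟩
        invFun p := p.1.1
        left_inv _ := rfl
        right_inv p := by
          have := DiscreteConvolution.mem_addFiber.1 p.2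
          ext
          · rfl
          · exact (eq_sub_of_add_eq' this).symm }
    rw [DiscreteConvolution.addConvolution, ← e.tsum_eq]
    refine Eq.trans ?_ (h1.trans (congr_fun (lp.coeFn_single (E := fun _ : Γ => ℂ) 1 0 1) η))
    rfl
  refine ⟨hf, g, ?_, hconv, ?_⟩
  · simpa using (lp.memℓp g).summable (by norm_num)
  · rw [DiscreteConvolution.addConvolution_comm _ _ _ fun x y => mul_comm x y, hconv]

end Wiener

/-! ### Characters, fibre sums and Fourier analysis on the torus -/

section Torus

open UnitAddTorus

/-- Every character of `ℤᵈ` is the evaluation of the monomials at a point of the torus. -/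
theorem exists_addChar_eq_mFourier {d : ℕ} (χ : AddChar (Fin d → ℤ) Circle) :
    ∃ x : UnitAddTorus (Fin d), ∀ n, (χ n : ℂ) = mFourier n x := by
  choose x hx using fun i => (AddCircle.homeomorphCircle (T := 1) one_ne_zero).surjective
    (χ (Pi.single i 1))
  refine ⟨x, fun n => ?_⟩
  have h : χ n = ∏ i, χ (Pi.single i 1) ^ n i := by
    conv_lhs => rw [← Finset.univ_sum_single n]
    have hsum : χ (∑ i, Pi.single i (n i)) = ∏ i, χ (Pi.single i (n i)) :=
      map_sum χ.toAddMonoidHom (fun i => Pi.single i (n i)) Finset.univ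
    refine hsum.trans (Finset.prod_congr rfl fun i _ => ?_)
    rw [← AddChar.map_zsmul_eq_zpow, ← Pi.single_smul, smul_eq_mul, mul_one]
  rw [h]
  change _ = ∏ i, fourier (n i) (x i)
  simp_rw [← hx, AddCircle.homeomorphCircle_apply, fourier_apply, AddCircle.toCircle_zsmul]
  exact map_prod Circle.coeHom _ _

end Torus

open UnitAddTorus

section Reindexing

variable {Γ ι : Type*} [AddCommGroup Γ] [DecidableEq Γ] [AddCommGroup ι]
variable {K : Type*} [TopologicalSpace K] [CompactSpace K] [MeasurableSpace K] [BorelSpace K]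
variable {m : Measure K} [IsProbabilityMeasure m]

/-- The Fuglede--Kadison determinant of an element of `L¹(Γ)` is a Mahler measure, if `Γ` is
identified with a Hilbert basis of characters. -/
theorem fkDet_regularRep_of_addEquiv (e : Γ ≃+ ι) (χ : ι → C(K, ℂ))
    (hχ : ∀ i j, χ (i + j) = χ i * χ j) (hχ0 : χ 0 = 1)
    (b : HilbertBasis ι ℂ (Lp ℂ 2 m)) (hb : ∀ i, b i = ContinuousMap.toLp 2 m ℂ (χ i))
    (h : Γ → ℂ) (Q : C(K, ℂ)) (hQ : HasSum (fun γ => h γ • χ (e γ)) Q) (hQ0 : ∀ x, Q x ≠ 0) :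
    fkDet (regularRep h) = mahlerMeasure m Q := by
  have hinj : Function.Injective fun γ => e (-γ) := e.injective.comp neg_injective
  have hsurj : Function.Surjective fun γ => e (-γ) := e.surjective.comp neg_surjective
  -- The basis is reindexed through `γ ↦ e (-γ)` to meet the sign convention of `fkDet_regularRep`.
  let b' : HilbertBasis Γ ℂ (Lp ℂ 2 m) := HilbertBasis.mk (b.orthonormal.comp _ hinj) (by
    rw [Set.range_comp b, hsurj.range_eq, Set.image_univ, b.dense_span])
  rw [mahlerMeasure_of_ne_zero Q hQ0]
  refine fkDet_regularRep (fun γ => χ (e γ)) (fun γ η => by rw [map_add, hχ])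
    (by rw [map_zero, hχ0]) b' (fun γ => ?_) h Q hQ hQ0
  rw [← hb, HilbertBasis.coe_mk]
  rfl

end Reindexing

section FibreSum

variable {Γ Γ' : Type*} [AddGroup Γ] [AddGroup Γ']

/-- Summing first over the fibres of `φ` shows that the Fourier series of `φ_* f` is that of `f`
with each character pulled back along `φ`. -/
theorem hasSum_fibreSum_smul {E : Type*} [NormedAddCommGroup E] [NormedSpace ℂ E]
    (φ : Γ →+ Γ') {f : Γ → ℂ} (hf : Summable fun γ => ‖f γ‖) (T : Γ' → E) {a : E}
    (h : HasSum (fun γ => f γ • T (φ γ)) a) : HasSum (fun k => fibreSum φ f k • T k) a := by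
  have h1 := (Equiv.sigmaFiberEquiv φ).hasSum_iff.mpr h
  refine h1.sigma fun k => ?_
  have h2 : HasSum (fun γ : {γ // φ γ = k} => f γ) (fibreSum φ f k) :=
    (hf.of_norm.subtype {γ | φ γ = k}).hasSum
  convert h2.smul_const (T k) using 2 with γ
  obtain ⟨γ, rfl⟩ := γ
  rfl

end FibreSum

section Torus

/-- The monomials as a Hilbert basis of the square integrable functions on the torus. -/
def torusBasis (d : ℕ) : HilbertBasis (Fin d → ℤ) ℂ (Lp ℂ 2 (torusHaar d)) := mFourierBasis

theorem torusBasis_apply (d : ℕ) (n : Fin d → ℤ) :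
    torusBasis d n = ContinuousMap.toLp 2 (torusHaar d) ℂ (mFourier n) :=
  congr_fun coe_mFourierBasis n

theorem integral_mFourier {d : ℕ} {n : Fin d → ℤ} (hn : n ≠ 0) :
    ∫ x, mFourier n x ∂torusHaar d = 0 := by
  have h : inner ℂ (torusBasis d 0) (torusBasis d n) = 0 := (torusBasis d).orthonormal.2 hn.symm
  rw [torusBasis_apply, torusBasis_apply, mFourier_zero, ContinuousMap.inner_toLp] at h
  simpa using h

theorem integral_fourier {n : ℤ} (hn : n ≠ 0) :
    ∫ x, (fourier n : C(UnitAddCircle, ℂ)) x ∂circleHaar = 0 := by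
  have h : inner ℂ (fourierLp (T := 1) 2 0) (fourierLp 2 n) = 0 :=
    (orthonormal_fourier (T := 1)).2 hn.symm
  rw [ContinuousMap.inner_toLp] at h
  simpa using h

theorem fkDet_regularRep_torus {d : ℕ} (f : (Fin d → ℤ) → ℂ) (P : C(UnitAddTorus (Fin d), ℂ))
    (h : HasSum (fun n => f n • mFourier n) P) (hP : ∀ x, P x ≠ 0) :
    fkDet (regularRep f) = mahlerMeasure (torusHaar d) P :=
  fkDet_regularRep_of_addEquiv (AddEquiv.refl _) mFourier
    (fun _ _ => ContinuousMap.ext fun _ => mFourier_add) mFourier_zero (torusBasis d)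
    (torusBasis_apply d) f P h hP

theorem mFourier_zsmul {d : ℕ} (n r : Fin d → ℤ) (x : UnitAddCircle) :
    mFourier n (fun i => r i • x) = fourier (∑ i, n i * r i) x := by
  change ∏ i, fourier (n i) (r i • x) = _
  have h (s : Finset (Fin d)) :
      ∏ i ∈ s, fourier (n i) (r i • x) = (fourier (∑ i ∈ s, n i * r i) x : ℂ) := by
    induction s using Finset.cons_induction with
    | empty => simp
    | cons i s hi ih =>
      rw [Finset.prod_cons, Finset.sum_cons, fourier_add, ih]
      congr 1
      rw [fourier_apply, fourier_apply, mul_smul]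
  exact h _

end Torus

/-! ### Restriction to lines and the limit formula -/

section Line

variable {d : ℕ}

theorem continuous_restrictToLine (P : C(UnitAddTorus (Fin d), ℂ)) (r : Fin d → ℤ) :
    Continuous (restrictToLine P r) :=
  P.continuous.comp <| continuous_pi fun i => continuous_zsmul (r i)

/-- The group `Γ_r` is trivial if `r = 0`. -/
theorem fkDet_regularRep_fibreSum_of_gcd_eq_zero (f : (Fin d → ℤ) → ℂ)
    (hf : Summable fun n => ‖f n‖) (P : C(UnitAddTorus (Fin d), ℂ))
    (h : HasSum (fun n => f n • mFourier n) P) (hP : ∀ x, P x ≠ 0) (r : Fin d → ℤ)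
    (hr : Finset.univ.gcd r = 0) :
    fkDet (regularRep (fibreSum (evalHom r) f)) =
      mahlerMeasure circleHaar (restrictToLine P r) := by
  have hr0 : ∀ i, r i = 0 := fun i => Finset.gcd_eq_zero_iff.1 hr i (Finset.mem_univ i)
  have hsub : Subsingleton (gcdSubgroup r) := by
    rw [gcdSubgroup, hr, AddSubgroup.zmultiples_zero_eq_bot]
    infer_instance
  -- The dual of the trivial group is a point, realised as the torus of dimension `0`; there the
  -- symbol is the constant `P 0`.
  let e : gcdSubgroup r ≃+ (Fin 0 → ℤ) :=
    { toFun _ := 0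
      invFun _ := 0
      left_inv _ := Subsingleton.elim _ _
      right_inv _ := Subsingleton.elim _ _
      map_add' _ _ := Subsingleton.elim _ _ }
  have hx : HasSum (fun n => f n • mFourier (e (evalHom r n)))
      (ContinuousMap.const (UnitAddTorus (Fin 0)) (P 0)) := by
    have := h.mapL ((ContinuousLinearMap.toSpanSingleton ℂ
      (1 : C(UnitAddTorus (Fin 0), ℂ))).comp (ContinuousMap.evalCLM ℂ 0))
    convert this using 1
    · ext1 n
      change f n • mFourier 0 = (f n • mFourier n 0) • _
      rw [mFourier_zero]
      congr 1
      simp [mFourier]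
    · ext x
      simp
  rw [fkDet_regularRep_of_addEquiv e mFourier
    (fun _ _ => ContinuousMap.ext fun _ => mFourier_add) mFourier_zero (torusBasis 0)
    (torusBasis_apply 0) _ _
    (hasSum_fibreSum_smul (evalHom r) hf (fun k => mFourier (e k)) hx) fun _ => hP 0]
  have hres : restrictToLine P r = ContinuousMap.const UnitAddCircle (P 0) := by
    ext x
    simp only [restrictToLine, hr0, zero_smul]
    rfl
  rw [hres, mahlerMeasure_of_ne_zero _ fun _ => hP 0, mahlerMeasure_of_ne_zero _ fun _ => hP 0]
  simp

/-- The identification of `Dℤ` with `ℤ`. -/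
def zmultiplesEquiv (D : ℤ) (hD : D ≠ 0) : AddSubgroup.zmultiples D ≃+ ℤ where
  toFun k := k / D
  invFun n := ⟨n * D, Int.mem_zmultiples_iff.2 (Dvd.intro_left n rfl)⟩
  left_inv k := Subtype.ext <| Int.ediv_mul_cancel (Int.mem_zmultiples_iff.1 k.2)
  right_inv n := Int.mul_ediv_cancel n hD
  map_add' k _ := Int.add_ediv_of_dvd_left (Int.mem_zmultiples_iff.1 k.2)

theorem zmultiplesEquiv_mul (D : ℤ) (hD : D ≠ 0) (k : AddSubgroup.zmultiples D) :
    zmultiplesEquiv D hD k * D = k :=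
  Int.ediv_mul_cancel (Int.mem_zmultiples_iff.1 k.2)

/-- After division by `D` the group is `ℤ`, with the circle as dual. The symbol `Q` and `P_r` differ
by the substitution `x ↦ D • x`, which is surjective and preserves Haar measure. -/
theorem fkDet_regularRep_fibreSum_of_gcd_ne_zero (f : (Fin d → ℤ) → ℂ)
    (hf : Summable fun n => ‖f n‖) (P : C(UnitAddTorus (Fin d), ℂ))
    (h : HasSum (fun n => f n • mFourier n) P) (hP : ∀ x, P x ≠ 0) (r : Fin d → ℤ)
    (hr : Finset.univ.gcd r ≠ 0) :
    fkDet (regularRep (fibreSum (evalHom r) f)) =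
      mahlerMeasure circleHaar (restrictToLine P r) := by
  let D := Finset.univ.gcd r
  let e : gcdSubgroup r ≃+ ℤ := zmultiplesEquiv D hr
  have hs : Summable fun n => f n • (fourier (e (evalHom r n)) : C(UnitAddCircle, ℂ)) := by
    refine .of_norm_bounded hf fun n => ?_
    rw [norm_smul, fourier_norm, mul_one]
  obtain ⟨Q, hQ⟩ := hs
  have hQP (x : UnitAddCircle) : Q (D • x) = restrictToLine P r x := by
    refine HasSum.unique (hQ.mapL (ContinuousMap.evalCLM ℂ (D • x))) ?_
    convert h.mapL (ContinuousMap.evalCLM ℂ fun i => r i • x) using 1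
    swap
    · rfl
    ext1 n
    change f n • fourier (e (evalHom r n)) (D • x) = f n • mFourier n fun i => r i • x
    have he : e (evalHom r n) * D = ∑ i, n i * r i := zmultiplesEquiv_mul D hr _
    rw [mFourier_zsmul, fourier_apply, fourier_apply, ← mul_smul, he]
  have hQ0 (x : UnitAddCircle) : Q x ≠ 0 := by
    -- The circle is divisible, so every value of `Q` is a value of `P`.
    have : D • DivisibleBy.div x D = x := DivisibleBy.div_cancel x hr
    rw [← this, hQP]
    exact hP _
  rw [fkDet_regularRep_of_addEquiv (m := circleHaar) e (fun n => fourier n)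
    (fun _ _ => ContinuousMap.ext fun _ => fourier_add) (ContinuousMap.ext fun _ => fourier_zero)
    fourierBasis (congr_fun coe_fourierBasis) _ Q
    (hasSum_fibreSum_smul (evalHom r) hf (fun k => fourier (e k)) hQ) hQ0]
  have hmp : MeasurePreserving (fun x : UnitAddCircle => D • x) circleHaar circleHaar :=
    Measure.measurePreserving_zsmul circleHaar hr
  have h1 := mahlerMeasure_of_ne_zero (m := circleHaar) Q hQ0
  have h2 := mahlerMeasure_of_ne_zero (m := circleHaar)
    ⟨restrictToLine P r, continuous_restrictToLine P r⟩ fun x => hP _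
  rw [h1]
  refine Eq.trans ?_ h2.symm
  congr 1
  simp only [ContinuousMap.coe_mk, ← hQP]
  conv_lhs => rw [← hmp.map_eq]
  rw [integral_map hmp.measurable.aemeasurable]
  have := Q.continuous.norm.log fun x => norm_ne_zero_iff.2 (hQ0 x)
  exact this.aestronglyMeasurable

/-- A relation `∑ n_i r_i = 0` would force `q(r) ≤ max |n_i|`. -/
theorem eventually_sum_mul_ne_zero {n : Fin d → ℤ} (hn : n ≠ 0) :
    ∀ᶠ r in lawtonFilter d, ∑ i, n i * r i ≠ 0 := by
  let N : ℕ∞ := ((Finset.univ.sup fun i => (n i).natAbs : ℕ) : ℕ∞)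
  have : ∀ᶠ q in 𝓝 (⊤ : ℕ∞), N < q := lt_mem_nhds (ENat.natCast_lt_top _)
  filter_upwards [this.comap lawtonQ] with r hr h0
  exact hr.not_ge (iInf₂_le n ⟨hn, h0⟩)

/-- The images of the circle under `x ↦ r x` are equidistributed for `q (r) → ∞`. -/
theorem tendsto_integral_restrictToLine (g : C(UnitAddTorus (Fin d), ℂ)) :
    Tendsto (fun r => ∫ x, restrictToLine g r x ∂circleHaar) (lawtonFilter d)
      (𝓝 (∫ x, g x ∂torusHaar d)) := by
  have hint (g : C(UnitAddTorus (Fin d), ℂ)) (r) : Integrable (restrictToLine g r) circleHaar :=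
    (continuous_restrictToLine g r).integrable_of_hasCompactSupport
      (HasCompactSupport.of_compactSpace _)
  have hint' (g : C(UnitAddTorus (Fin d), ℂ)) : Integrable g (torusHaar d) :=
    g.continuous.integrable_of_hasCompactSupport (HasCompactSupport.of_compactSpace _)
  have hspan : ∀ p ∈ Submodule.span ℂ (Set.range (mFourier (d := Fin d))),
      Tendsto (fun r => ∫ x, restrictToLine p r x ∂circleHaar) (lawtonFilter d)
      (𝓝 (∫ x, p x ∂torusHaar d)) := by
    intro p hp
    induction hp using Submodule.span_induction with
    | mem p hp =>
      obtain ⟨n, rfl⟩ := hp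
      simp only [restrictToLine, mFourier_zsmul]
      by_cases hn : n = 0
      · simpa [hn, mFourier_zero] using tendsto_const_nhds
      · rw [integral_mFourier hn]
        refine tendsto_const_nhds.congr' ?_
        filter_upwards [eventually_sum_mul_ne_zero hn] with r hr
        exact (integral_fourier hr).symm
    | zero => simpa [restrictToLine] using tendsto_const_nhds
    | add p q _ _ hp hq =>
      simp only [ContinuousMap.add_apply]
      rw [integral_add (hint' p) (hint' q)]
      refine (hp.add hq).congr fun r => ?_
      rw [← integral_add (hint p r) (hint q r)]
      rfl
    | smul c p _ hp =>
      simp only [ContinuousMap.smul_apply]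
      rw [integral_smul]
      refine (hp.const_smul c).congr fun r => ?_
      rw [← integral_smul]
      rfl
  rw [Metric.tendsto_nhds]
  intro ε hε
  have hg : g ∈ closure (Submodule.span ℂ (Set.range (mFourier (d := Fin d))) :
      Set C(UnitAddTorus (Fin d), ℂ)) := by
    rw [← Submodule.topologicalClosure_coe, span_mFourier_closure_eq_top]
    trivial
  -- Replacing `g` by the trigonometric polynomial `p` costs `ε / 3` in each of the two integrals,
  -- uniformly in `r`, as the measures are probability measures.
  obtain ⟨p, hp, hgp⟩ := Metric.mem_closure_iff.1 hg (ε / 3) (by positivity)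
  have hpt (x) : ‖g x - p x‖ ≤ ε / 3 := by
    rw [← dist_eq_norm]
    exact (ContinuousMap.dist_apply_le_dist x).trans hgp.le
  have h1 (r) : dist (∫ x, restrictToLine g r x ∂circleHaar)
      (∫ x, restrictToLine p r x ∂circleHaar) ≤ ε / 3 := by
    rw [dist_eq_norm, ← integral_sub (hint g r) (hint p r)]
    simpa using norm_integral_le_of_norm_le_const (μ := circleHaar)
      (f := fun x => restrictToLine g r x - restrictToLine p r x) (.of_forall fun x => hpt _)
  have h2 : dist (∫ x, p x ∂torusHaar d) (∫ x, g x ∂torusHaar d) ≤ ε / 3 := by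
    rw [dist_comm, dist_eq_norm, ← integral_sub (hint' g) (hint' p)]
    simpa using norm_integral_le_of_norm_le_const (μ := torusHaar d) (.of_forall fun x => hpt x)
  filter_upwards [Metric.tendsto_nhds.1 (hspan p hp) (ε / 3) (by positivity)] with r hr
  have := dist_triangle4 (∫ x, restrictToLine g r x ∂circleHaar)
    (∫ x, restrictToLine p r x ∂circleHaar) (∫ x, p x ∂torusHaar d) (∫ x, g x ∂torusHaar d)
  linarith [h1 r]

/-- Lawton's limit formula for Mahler measures of functions without zeros. -/
theorem tendsto_mahlerMeasure_restrictToLine (P : C(UnitAddTorus (Fin d), ℂ))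
    (hP : ∀ x, P x ≠ 0) :
    Tendsto (fun r => mahlerMeasure circleHaar (restrictToLine P r)) (lawtonFilter d)
      (𝓝 (mahlerMeasure (torusHaar d) P)) := by
  let l : C(UnitAddTorus (Fin d), ℂ) := ⟨fun x => Real.log ‖P x‖, by
    have := P.continuous.norm.log fun x => norm_ne_zero_iff.2 (hP x)
    fun_prop⟩
  have h := Complex.continuous_re.continuousAt.tendsto.comp (tendsto_integral_restrictToLine l)
  have hl : (∫ x, l x ∂torusHaar d).re = ∫ x, Real.log ‖P x‖ ∂torusHaar d := by
    change (∫ x, ((Real.log ‖P x‖ : ℝ) : ℂ) ∂torusHaar d).re = _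
    rw [integral_complex_ofReal, Complex.ofReal_re]
  rw [hl] at h
  rw [mahlerMeasure_of_ne_zero P hP]
  refine ((Real.continuous_exp.tendsto _).comp h).congr fun r => ?_
  have h2 := mahlerMeasure_of_ne_zero (m := circleHaar)
    ⟨restrictToLine P r, continuous_restrictToLine P r⟩ fun x => hP _
  refine Eq.trans ?_ h2.symm
  simp only [Function.comp_apply]
  congr 1
  change (∫ x, ((Real.log ‖restrictToLine P r x‖ : ℝ) : ℂ) ∂circleHaar).re = _
  rw [integral_complex_ofReal, Complex.ofReal_re]
  rfl

end Line

end

end FugledeKadison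

theorem mainTheorem7 (d : ℕ) (P : C(UnitAddTorus (Fin d), ℂ)) (f : (Fin d → ℤ) → ℂ)
    (hf : ∀ n, f n = UnitAddTorus.mFourierCoeff P n)
    (hsum : Summable fun n => ‖f n‖)
    (hP : ∀ x, P x ≠ 0) :
    -- `P = ℱ(f)`, and `f` is a unit of `L¹(ℤᵈ)`
    (∀ x, HasSum (fun n => f n * UnitAddTorus.mFourier n x) (P x)) ∧
    FugledeKadison.IsL1Unit f ∧
    -- the determinants are Mahler measures
    FugledeKadison.fkDet (FugledeKadison.regularRep f) =
      FugledeKadison.mahlerMeasure (FugledeKadison.torusHaar d) P ∧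
    (∀ r : Fin d → ℤ,
      FugledeKadison.fkDet (FugledeKadison.regularRep
          (FugledeKadison.fibreSum (FugledeKadison.evalHom r) f)) =
        FugledeKadison.mahlerMeasure FugledeKadison.circleHaar
          (FugledeKadison.restrictToLine P r)) ∧
    -- the limit formulas
    Tendsto (fun r : Fin d → ℤ => FugledeKadison.fkDet (FugledeKadison.regularRep
          (FugledeKadison.fibreSum (FugledeKadison.evalHom r) f)))
      (FugledeKadison.lawtonFilter d)
      (𝓝 (FugledeKadison.fkDet (FugledeKadison.regularRep f))) ∧
    Tendsto (fun r : Fin d → ℤ => FugledeKadison.mahlerMeasure FugledeKadison.circleHaar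
          (FugledeKadison.restrictToLine P r))
      (FugledeKadison.lawtonFilter d)
      (𝓝 (FugledeKadison.mahlerMeasure (FugledeKadison.torusHaar d) P)) := by
  have hfun : f = UnitAddTorus.mFourierCoeff P := funext hf
  have hsummable : Summable (UnitAddTorus.mFourierCoeff P) := hfun ▸ hsum.of_norm
  have hx (x) : HasSum (fun n => f n * UnitAddTorus.mFourier n x) (P x) := by
    rw [hfun]
    exact UnitAddTorus.hasSum_mFourier_series_apply_of_summable hsummable x
  have hP' : HasSum (fun n => f n • UnitAddTorus.mFourier n) P := by
    rw [hfun]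
    exact UnitAddTorus.hasSum_mFourier_series_of_summable hsummable
  have hdet := FugledeKadison.fkDet_regularRep_torus f P hP' hP
  have hdetr (r : Fin d → ℤ) : FugledeKadison.fkDet (FugledeKadison.regularRep
      (FugledeKadison.fibreSum (FugledeKadison.evalHom r) f)) =
      FugledeKadison.mahlerMeasure FugledeKadison.circleHaar
        (FugledeKadison.restrictToLine P r) := by
    by_cases hr : Finset.univ.gcd r = 0
    · exact FugledeKadison.fkDet_regularRep_fibreSum_of_gcd_eq_zero f hsum P hP' hP r hr
    · exact FugledeKadison.fkDet_regularRep_fibreSum_of_gcd_ne_zero f hsum P hP' hP r hr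
  have hlim := FugledeKadison.tendsto_mahlerMeasure_restrictToLine P hP
  refine ⟨hx, ?_, hdet, hdetr, ?_, hlim⟩
  · refine FugledeKadison.isL1Unit_of_forall_addChar f hsum fun χ => ?_
    obtain ⟨x, hχ⟩ := FugledeKadison.exists_addChar_eq_mFourier χ
    simp only [hχ, (hx x).tsum_eq]
    exact hP x
  · rw [hdet]
    exact hlim.congr fun r => (hdetr r).symm
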